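/- Let $n\ge 1$ be an integer and let $S_n$ be the group of permutations of $\{0,1,\dots,n-1\}$, where $\pi\in S_n$ is written as the vector $(\pi(0),\dots,\pi(n-1))$ and $\pi\sigma$ denotes the composition $x\mapsto\pi(\sigma(x))$. For $0\le i\le n-1$ and $1\le s\le n-i$ let $\kappa_{i,s}\in S_n$ be the permutation that fixes $0,\dots,i-1$ and rotates the suffix by $s$, $$\kappa_{i,s}=(0,\dots,i-1,\;i+s,i+s+1,\dots,n-1,\;i,i+1,\dots,i+s-1),$$ with $\kappa_{i,n-i}$ the identity. Let $V_n$ be the set of integer vectors $[a_0,\dots,a_{n-1}]$ with $1\le a_j\le j+1$ for all $j$. The map $$[a_0,\dots,a_{n-1}]\mapsto \kappa_{n-2,a_1}\,\kappa_{n-3,a_2}\cdots\kappa_{1,a_{n-2}}\,\kappa_{0,a_{n-1}}$$ is a bijection from $V_n$ onto $S_n$; let $R:S_n\to V_n$ be its inverse. For $T\in\mathbb{Z}$ let $$\mathcal{W}_{T,n}=\{[a_0,\dots,a_{n-1}]\in V_n:\ a_0+a_1+\dots+a_{n-1}\equiv T \pmod n\},\qquad \mathcal{C}_{T,n}=\{(R^{-1}(\alpha))^{-1}:\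 \alpha\in\mathcal{W}_{T,n}\}\subseteq S_n .$$ A (stable) deletion at position $i$ turns $\pi$ into the sequence $(\pi(0),\dots,\pi(i-1),\pi(i+1),\dots,\pi(n-1))$. A set $\mathcal{C}\subseteq S_n$ is single-deletion-correcting if no sequence can be obtained by one deletion from two different elements of $\mathcal{C}$ (the deleted positions may differ), and it is then called perfect if $|\mathcal{C}|=(n-1)!$. Theorem. 1. If $T_1\not\equiv T_2\pmod n$, then $\mathcal{C}_{T_1,n}$ and $\mathcal{C}_{T_2,n}$ are disjoint; and the $n$ codes $\mathcal{C}_{0,n},\dots,\mathcal{C}_{n-1,n}$ form a partition of $S_n$ (into non-empty sets). 2. For every integer $T$, the code $\mathcal{C}_{T,n}$ has exactly $(n-1)!$ elements and is single-deletion-correcting; hence it is a perfect single-deletion-correcting permutation code. -/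

import Mathlib

/-! Permutations of length `n` are elements of `Equiv.Perm (Fin n)`; the vector representation of
`π` is `(π 0, π 1, …, π (n - 1))`, and `π * σ` is the composition `x ↦ π (σ x)`. -/

namespace DeletionCode

/-- The symbol at position `x` of the suffix block transposition `κ_{i,s}`: the positions below `i`
are fixed and the suffix `i, …, n - 1` is rotated by `s`. -/
def kappaFun (n i s : ℕ) (x : Fin n) : Fin n :=
  if h : (x : ℕ) < i then x
  else ⟨i + ((x - i + s) % (n - i)), by
    have := x.isLt
    have := Nat.mod_lt (x - i + s) (show 0 < n - i by omega)
    omega⟩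

theorem kappaFun_val_lt {n i s : ℕ} {x : Fin n} (h : (x : ℕ) < i) : kappaFun n i s x = x := by
  simp [kappaFun, h]

theorem kappaFun_val_ge {n i s : ℕ} {x : Fin n} (h : i ≤ (x : ℕ)) :
    (kappaFun n i s x : ℕ) = i + ((x - i + s) % (n - i)) := by
  simp [kappaFun, Nat.not_lt.mpr h]

theorem kappaFun_injective (n i s : ℕ) : Function.Injective (kappaFun n i s) := by
  intro x y hxy
  have hx := x.isLt
  have hy := y.isLt
  have hv : (kappaFun n i s x : ℕ) = kappaFun n i s y := by rw [hxy]
  rcases Nat.lt_or_ge x i with h1 | h1 <;> rcases Nat.lt_or_ge y i with h2 | h2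
  · rwa [kappaFun_val_lt h1, kappaFun_val_lt h2] at hxy
  · rw [kappaFun_val_lt h1, kappaFun_val_ge h2] at hv
    omega
  · rw [kappaFun_val_ge h1, kappaFun_val_lt h2] at hv
    omega
  · rw [kappaFun_val_ge h1, kappaFun_val_ge h2] at hv
    have h3 : (x - i + s) ≡ (y - i + s) [MOD (n - i)] := by
      unfold Nat.ModEq
      omega
    have h4 : ((x : ℕ) - i) ≡ (y - i) [MOD (n - i)] := Nat.ModEq.add_right_cancel' s h3
    have h5 := Nat.ModEq.eq_of_lt_of_lt h4 (by omega) (by omega)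
    exact Fin.ext (by omega)

/-- The suffix block transposition `κ_{i,s}`. For `i < n` and `1 ≤ s ≤ n - i - 1` its vector
representation is `(0, …, i - 1, i + s, i + s + 1, …, n - 1, i, i + 1, …, i + s - 1)`, and
`κ_{i,n-i}` is the identity. -/
noncomputable def kappa (n i s : ℕ) : Equiv.Perm (Fin n) :=
  Equiv.ofBijective (kappaFun n i s) (Finite.injective_iff_bijective.mp (kappaFun_injective n i s))

/-- `V_n`: the vectors `[a_0, …, a_{n-1}]` of integers with `1 ≤ a_j ≤ j + 1`. -/
def V (n : ℕ) : Set (Fin n → ℕ) :=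
  {a | ∀ j : Fin n, 1 ≤ a j ∧ a j ≤ (j : ℕ) + 1}

/-- The product `κ_{n-1,a_0} κ_{n-2,a_1} κ_{n-3,a_2} ⋯ κ_{1,a_{n-2}} κ_{0,a_{n-1}}`. On `V_n` one has
`a_0 = 1`, so that the first factor `κ_{n-1,1}` is the identity. -/
noncomputable def ofVec {n : ℕ} (a : Fin n → ℕ) : Equiv.Perm (Fin n) :=
  (List.ofFn fun j : Fin n => kappa n (n - 1 - j) (a j)).prod

/-! The map `ofVec` is a bijection from `V_n` onto `S_n`. -/

/-- The product of the first `m` factors. -/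
noncomputable def partialVec (n : ℕ) (f : ℕ → ℕ) (m : ℕ) : Equiv.Perm (Fin n) :=
  ((List.range m).map fun j => kappa n (n - 1 - j) (f j)).prod

theorem partialVec_succ (n : ℕ) (f : ℕ → ℕ) (m : ℕ) :
    partialVec n f (m + 1) = partialVec n f m * kappa n (n - 1 - m) (f m) := by
  simp [partialVec, List.range_succ]

theorem partialVec_fix (n : ℕ) (f : ℕ → ℕ) (m : ℕ) (x : Fin n) (h : (x : ℕ) < n - m) :
    partialVec n f m x = x := by
  induction m with
  | zero => simp [partialVec]
  | succ m ih =>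
    have h1 : kappa n (n - 1 - m) (f m) x = x := kappaFun_val_lt (by omega)
    rw [partialVec_succ, Equiv.Perm.mul_apply, h1, ih (by omega)]

theorem partialVec_inj (n : ℕ) (f g : ℕ → ℕ) (m : ℕ) (hm : m ≤ n)
    (hf : ∀ j < m, 1 ≤ f j ∧ f j ≤ j + 1) (hg : ∀ j < m, 1 ≤ g j ∧ g j ≤ j + 1)
    (h : partialVec n f m = partialVec n g m) : ∀ j < m, f j = g j := by
  induction m with
  | zero => intro j hj; omega
  | succ m ih =>
    rw [partialVec_succ, partialVec_succ] at h
    have key : f m = g m := by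
      let i : Fin n := ⟨n - 1 - m, by omega⟩
      obtain ⟨z, hz⟩ := (kappa n (n - 1 - m) (f m)).surjective i
      have hi : (i : ℕ) = n - 1 - m := rfl
      have h1 := Equiv.congr_fun h z
      rw [Equiv.Perm.mul_apply, Equiv.Perm.mul_apply, hz,
        partialVec_fix n f m i (by omega)] at h1
      have h2 : kappa n (n - 1 - m) (g m) z = i := by
        apply (partialVec n g m).injective
        rw [← h1, partialVec_fix n g m i (by omega)]
      have hz' : kappaFun n (n - 1 - m) (f m) z = i := hz
      have h2' : kappaFun n (n - 1 - m) (g m) z = i := h2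
      have hzi : n - 1 - m ≤ (z : ℕ) := by
        by_contra hlt
        rw [kappaFun_val_lt (by omega)] at hz'
        rw [hz'] at hlt
        omega
      have e1 := congrArg Fin.val hz'
      have e2 := congrArg Fin.val h2'
      rw [kappaFun_val_ge hzi] at e1 e2
      have e3 : (z - (n - 1 - m) + f m) ≡ (z - (n - 1 - m) + g m) [MOD (n - (n - 1 - m))] := by
        unfold Nat.ModEq
        omega
      have e4 : f m ≡ g m [MOD (n - (n - 1 - m))] := Nat.ModEq.add_left_cancel' _ e3
      have e5 : n - (n - 1 - m) = m + 1 := by omega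
      rw [e5] at e4
      have f1 := hf m (by omega)
      have g1 := hg m (by omega)
      have e6 : (f m - 1) ≡ (g m - 1) [MOD (m + 1)] := by
        apply Nat.ModEq.add_right_cancel' 1
        rwa [Nat.sub_add_cancel f1.1, Nat.sub_add_cancel g1.1]
      have e7 := Nat.ModEq.eq_of_lt_of_lt e6 (by omega) (by omega)
      omega
    rw [key] at h
    have ih' := ih (by omega) (fun j hj => hf j (by omega)) (fun j hj => hg j (by omega))
      (mul_right_cancel h)
    intro j hj
    rcases Nat.lt_succ_iff_lt_or_eq.mp hj with h' | h'
    · exact ih' j h'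
    · rw [h', key]

theorem ofVec_eq_partialVec {n : ℕ} (a : Fin n → ℕ) :
    ofVec a = partialVec n (fun j => if h : j < n then a ⟨j, h⟩ else 0) n := by
  unfold ofVec partialVec
  congr 1
  apply List.ext_getElem
  · simp
  · intro k h1 h2
    have hk : k < n := by simpa using h1
    simp [hk]

theorem ofVec_injOn (n : ℕ) : Function.Injective (fun a : V n => ofVec a.1) := by
  rintro ⟨a, ha⟩ ⟨b, hb⟩ h
  simp only [ofVec_eq_partialVec] at h
  have h' := partialVec_inj n _ _ n le_rfl
    (fun j hj => by simpa [hj] using ha ⟨j, hj⟩) (fun j hj => by simpa [hj] using hb ⟨j, hj⟩) h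
  refine Subtype.ext (funext fun j => ?_)
  simpa using h' j j.isLt

/-- Shifting each component down by one identifies `V_n` with a product of finite types. -/
def vEquiv (n : ℕ) : V n ≃ ((j : Fin n) → Fin ((j : ℕ) + 1)) where
  toFun a j := ⟨a.1 j - 1, by have := a.2 j; omega⟩
  invFun b := ⟨fun j => b j + 1, fun j => by have := (b j).isLt; simp only []; omega⟩
  left_inv a := Subtype.ext (funext fun j => by have := a.2 j; simp only []; omega)
  right_inv b := by funext j; simp

theorem ofVec_bijective (n : ℕ) : Function.Bijective (fun a : V n => ofVec a.1) := by
  classical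
  have : Fintype (V n) := Fintype.ofEquiv _ (vEquiv n).symm
  rw [Fintype.bijective_iff_injective_and_card]
  refine ⟨ofVec_injOn n, ?_⟩
  rw [Fintype.card_congr (vEquiv n), Fintype.card_pi, Fintype.card_perm, Fintype.card_fin]
  simp only [Fintype.card_fin]
  rw [Fin.prod_univ_eq_prod_range (fun j => j + 1) n, Finset.prod_range_add_one_eq_factorial]

/-- The representation `R : S_n → V_n`: `R π` is the unique vector `[a_0, …, a_{n-1}]` in `V_n` with
`π = κ_{n-2,a_1} κ_{n-3,a_2} ⋯ κ_{0,a_{n-1}}`. -/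
noncomputable def R (n : ℕ) : Equiv.Perm (Fin n) ≃ V n :=
  (Equiv.ofBijective (fun a : V n => ofVec a.1) (ofVec_bijective n)).symm

/-- `W_{T,n}`: the vectors in `V_n` whose component sum is congruent to `T` modulo `n`. -/
def W (T : ℤ) (n : ℕ) : Set (V n) :=
  {a | (∑ j : Fin n, (a.1 j : ℤ)) ≡ T [ZMOD (n : ℤ)]}

/-- The permutation code `C_{T,n} = {(R⁻¹ α)⁻¹ : α ∈ W_{T,n}}`. -/
def code (T : ℤ) (n : ℕ) : Set (Equiv.Perm (Fin n)) :=
  {π | ∃ a ∈ W T n, π = ((R n).symm a)⁻¹}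

/-- What is received when the symbol at position `i` of the vector representation of `π` is deleted:
the sequence `(π 0, …, π (i - 1), π (i + 1), …, π (n - 1))`. -/
def deleteAt {n : ℕ} (π : Equiv.Perm (Fin n)) (i : Fin n) : List (Fin n) :=
  (List.ofFn fun x : Fin n => π x).eraseIdx i

/-- A permutation code is single-deletion-correcting if a codeword can be recovered from the sequence
received after the deletion of any one of its symbols: no sequence can be received from two different
codewords. -/
def SingleDeletionCorrecting {n : ℕ} (C : Set (Equiv.Perm (Fin n))) : Prop :=
  ∀ π ∈ C, ∀ σ ∈ C, ∀ i j : Fin n, deleteAt π i = deleteAt σ j → π = σ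

/-- A perfect single-deletion-correcting permutation code is one of cardinality `(n - 1)!`. -/
def IsPerfect {n : ℕ} (C : Set (Equiv.Perm (Fin n))) : Prop :=
  SingleDeletionCorrecting C ∧ C.ncard = (n - 1).factorial

end DeletionCode

namespace DeletionCode

open Finset

/-! The component sum of `R π⁻¹` is, up to sign and a constant, a descent statistic of `π`. Left
multiplication by `κ_{i,s}` shifts values cyclically and changes `comajor` by `n - i - s`; peeling
off the factors of `π⁻¹` one at a time gives `comajor π + ∑ a_j = ∑ (j + 1)` (`comajor_ofVec_inv`).
Since `comajor + major` is a multiple of `n`, each code consists of the permutations with a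
prescribed major index modulo `n`.

A sequence with one deletion reveals the missing letter but not its position. Inserting a given new
letter at the `n` possible positions yields major indices that are pairwise distinct modulo `n`
(`eq_of_major_insertLetter_modEq`), so the residue recovers the position.

For the cardinality, the last component runs through a complete residue system modulo `n`, so the
other components are free (`initV_bijective`). -/

/-- The indicator of `b < a`. -/
def descent (a b : ℕ) : ℤ := if b < a then 1 else 0

/-- The vector representation of `π` as a function on `ℕ`, continued by the constant `n`. -/
def word {n : ℕ} (π : Equiv.Perm (Fin n)) (k : ℕ) : ℕ := if h : k < n then π ⟨k, h⟩ else n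

/-- The sum over the descents of `π` of the number of symbols to the right of the descent. -/
def comajor {n : ℕ} (π : Equiv.Perm (Fin n)) : ℤ :=
  ∑ k ∈ range n, ((n : ℤ) - 1 - k) * descent (word π k) (word π (k + 1))

/-- The major index of the first `N + 1` letters of a word. -/
def major (w : ℕ → ℕ) (N : ℕ) : ℤ :=
  ∑ v ∈ range (N + 1), (v : ℤ) * descent (w (v - 1)) (w v)

/-- Abel summation; it turns a change of descents of the form `g (k + 1) - g k` into a count. -/
theorem sum_mul_sub (g : ℕ → ℤ) (n : ℕ) :
    ∑ k ∈ range n, ((n : ℤ) - 1 - k) * (g (k + 1) - g k) = ∑ k ∈ range n, g k - n * g 0 := by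
  induction n with
  | zero => simp
  | succ n ih =>
    have h : ∑ k ∈ range n, (((n + 1 : ℕ) : ℤ) - 1 - k) * (g (k + 1) - g k) =
        ∑ k ∈ range n, ((n : ℤ) - 1 - k) * (g (k + 1) - g k) +
          ∑ k ∈ range n, (g (k + 1) - g k) := by
      rw [← sum_add_distrib]
      refine sum_congr rfl fun k _ => ?_
      push_cast
      ring
    rw [sum_range_succ, h, ih, sum_range_sub, sum_range_succ]
    push_cast
    ring

/-! ### The component sum determines the major index -/

theorem word_lt {n : ℕ} (π : Equiv.Perm (Fin n)) {k : ℕ} (h : k < n) :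
    word π k = π ⟨k, h⟩ := by
  simp [word, h]

/-- A cyclic shift of the values preserves the order of two letters unless exactly one of them wraps
around. Hence the descent indicators change by a difference of `U`, the indicator of the shifted
values that do not wrap, and there are `n - i - s` of these. -/
theorem comajor_kappa_mul {n i s : ℕ} (τ : Equiv.Perm (Fin n)) (hi : i < n) (hs : 1 ≤ s)
    (hsn : s ≤ n - i) (hfix : ∀ x : Fin n, (x : ℕ) < i → τ x = x)
    (hτ : kappa n i s (τ ⟨i, hi⟩) = ⟨i, hi⟩) :
    comajor τ = comajor (kappa n i s * τ) + ((n : ℤ) - i - s) := by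
  let U : ℕ → ℤ := fun y => if i ≤ y ∧ y < n - s then 1 else 0
  have hge : ∀ x : Fin n, i ≤ (x : ℕ) → i ≤ (τ x : ℕ) := by
    intro x hx
    by_contra hlt
    have := τ.injective (hfix (τ x) (by omega))
    rw [this] at hlt
    omega
  have hkge : ∀ y : Fin n, i ≤ (y : ℕ) → (kappa n i s y : ℕ) =
      if (y : ℕ) < n - s then (y : ℕ) + s else y + s - (n - i) := by
    intro y hy
    have e : (kappa n i s y : ℕ) = i + ((y - i + s) % (n - i)) := kappaFun_val_ge hy
    have := y.isLt
    rw [e]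
    split_ifs with h
    · rw [Nat.mod_eq_of_lt (by omega)]; omega
    · rw [Nat.mod_eq_sub_mod (by omega), Nat.mod_eq_of_lt (by omega)]; omega
  have hklt : ∀ y : Fin n, (y : ℕ) < i → kappa n i s y = y := fun y hy => kappaFun_val_lt hy
  -- The value sent to `i` is `n - s`, the first one that wraps.
  have hUi : U (τ ⟨i, hi⟩) = 0 := by
    have h1 := hkge _ (hge ⟨i, hi⟩ le_rfl)
    rw [hτ] at h1
    have h2 := hge ⟨i, hi⟩ le_rfl
    simp only [U]
    split_ifs at h1 ⊢ <;> simp only [] at h1 <;> omega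
  have hU0 : U (word τ 0) = 0 := by
    rw [word_lt τ (by omega : 0 < n)]
    rcases Nat.eq_zero_or_pos i with h | h
    · subst h; exact hUi
    · rw [hfix _ h]; simp only [U]; rw [if_neg]; omega
  have hterm : ∀ k ∈ range n, ((n : ℤ) - 1 - k) * descent (word τ k) (word τ (k + 1)) =
      ((n : ℤ) - 1 - k) * descent (word (kappa n i s * τ) k) (word (kappa n i s * τ) (k + 1)) +
        ((n : ℤ) - 1 - k) * (U (word τ (k + 1)) - U (word τ k)) := by
    intro k hk
    rw [mem_range] at hk
    rcases Nat.lt_or_ge (k + 1) n with hk1 | hk1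
    · rw [← mul_add]
      congr 1
      rw [word_lt _ hk, word_lt _ hk1, word_lt _ hk, word_lt _ hk1, Equiv.Perm.mul_apply,
        Equiv.Perm.mul_apply]
      rcases Nat.lt_or_ge k i with h1 | h1
      · rw [hfix ⟨k, hk⟩ h1, hklt ⟨k, hk⟩ h1]
        rcases Nat.lt_or_ge (k + 1) i with h2 | h2
        · rw [hfix ⟨k + 1, hk1⟩ h2, hklt ⟨k + 1, hk1⟩ h2]
          simp only [U]
          rw [if_neg (by omega), if_neg (by omega)]
          simp
        · obtain rfl : i = k + 1 := by omega
          rw [hUi, hτ]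
          have := hge ⟨k + 1, hk1⟩ le_rfl
          simp only [U, descent]
          rw [if_neg (by omega), if_neg (by omega), if_neg (by omega)]
          simp
      · have g1 := hge ⟨k, hk⟩ h1
        have g2 := hge ⟨k + 1, hk1⟩ (by simp only []; omega)
        have b1 := (τ ⟨k, hk⟩).isLt
        have b2 := (τ ⟨k + 1, hk1⟩).isLt
        simp only [descent, U]
        rw [hkge _ g1, hkge _ g2]
        split_ifs <;> omega
    -- The pair formed with the padding letter has weight zero.
    · have : (n : ℤ) - 1 - k = 0 := by omega
      rw [this]; simp
  have hsum : ∑ k ∈ range n, U (word τ k) = (n : ℤ) - i - s := by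
    rw [← Fin.sum_univ_eq_sum_range (fun k => U (word τ k)) n]
    have e : ∀ x : Fin n, U (word τ x) = U (τ x : ℕ) := fun x => by rw [word_lt τ x.isLt]
    rw [sum_congr rfl fun x _ => e x, Equiv.sum_comp τ (fun y : Fin n => U (y : ℕ)),
      Fin.sum_univ_eq_sum_range U n]
    simp only [U]
    rw [sum_boole]
    have : (range n).filter (fun y => i ≤ y ∧ y < n - s) = Ico i (n - s) := by
      ext y; simp only [mem_filter, mem_range, mem_Ico]; omega
    rw [this, Nat.card_Ico]
    omega
  unfold comajor
  rw [sum_congr rfl hterm, sum_add_distrib, sum_mul_sub (fun k => U (word τ k)), hsum, hU0]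
  simp

theorem comajor_one (n : ℕ) : comajor (1 : Equiv.Perm (Fin n)) = 0 := by
  refine sum_eq_zero fun k hk => ?_
  rw [mem_range] at hk
  have : descent (word (1 : Equiv.Perm (Fin n)) k) (word (1 : Equiv.Perm (Fin n)) (k + 1)) = 0 := by
    rw [word_lt _ hk]
    unfold word descent
    simp only [Equiv.Perm.one_apply]
    split_ifs <;> omega
  rw [this, mul_zero]

/-- The last factor of the product is the leftmost one of the inverse up to inversion, so a left
multiplication cancels it. With `i = n - 1 - j` and `s = f j` the change `n - i - s` is `j + 1 - f
j`. -/
theorem comajor_partialVec_inv (n : ℕ) (f : ℕ → ℕ) (m : ℕ) (hm : m ≤ n)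
    (hf : ∀ j < m, 1 ≤ f j ∧ f j ≤ j + 1) :
    comajor (partialVec n f m)⁻¹ = ∑ j ∈ range m, ((j : ℤ) + 1 - f j) := by
  induction m with
  | zero => simp [partialVec, comajor_one]
  | succ m ih =>
    have hfm := hf m (by omega)
    have hinv : ∀ k, ∀ x : Fin n, (x : ℕ) < n - k → (partialVec n f k)⁻¹ x = x := by
      intro k x hx
      rw [Equiv.Perm.inv_eq_iff_eq, partialVec_fix n f k x hx]
    have hmul : kappa n (n - 1 - m) (f m) * (partialVec n f (m + 1))⁻¹ =
        (partialVec n f m)⁻¹ := by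
      rw [partialVec_succ, mul_inv_rev, mul_inv_cancel_left]
    have h := comajor_kappa_mul (n := n) (i := n - 1 - m) (s := f m)
      (partialVec n f (m + 1))⁻¹ (by omega) hfm.1 (by omega)
      (fun x hx => hinv (m + 1) x (by omega))
      (by rw [← Equiv.Perm.mul_apply, hmul]; exact hinv m _ (by simp only []; omega))
    rw [h, hmul, ih (by omega) (fun j hj => hf j (by omega)), sum_range_succ]
    congr 1
    omega

theorem comajor_ofVec_inv {n : ℕ} (a : V n) :
    comajor (ofVec a.1)⁻¹ = ∑ j : Fin n, (((j : ℕ) : ℤ) + 1 - a.1 j) := by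
  rw [ofVec_eq_partialVec, comajor_partialVec_inv n _ n le_rfl
    (fun j hj => by simpa [hj] using a.2 ⟨j, hj⟩), ← Fin.sum_univ_eq_sum_range
    (fun j => (j : ℤ) + 1 - ((if h : j < n then a.1 ⟨j, h⟩ else 0 : ℕ) : ℤ))]
  simp

/-- A descent between positions `k` and `k + 1` weighs `n - 1 - k` in `comajor` and `k + 1` in
`major`. -/
theorem comajor_add_major {n : ℕ} (π : Equiv.Perm (Fin n)) :
    comajor π + major (word π) n =
      n * ∑ k ∈ range n, descent (word π k) (word π (k + 1)) := by
  unfold comajor major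
  rw [sum_range_succ', mul_sum, Nat.cast_zero, zero_mul, add_zero, ← sum_add_distrib]
  refine sum_congr rfl fun k _ => ?_
  simp only [Nat.add_sub_cancel]
  push_cast
  ring

/-! ### The major index after an insertion -/

/-- The word obtained from `u` by inserting `x` at position `p`. -/
def insertLetter (u : ℕ → ℕ) (x p k : ℕ) : ℕ := if k < p then u k else if k = p then x else u (k - 1)

/-- Each descent to the right of the insertion moves one place and gains 1; the pair `u (p - 1), u
p` is replaced by two pairs of weights `p` and `p + 1`. For `p = 0` the terms with the truncated `p
- 1` have weight zero. -/
theorem major_insertLetter (u : ℕ → ℕ) (x p N : ℕ) (h : p ≤ N) :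
    major (insertLetter u x p) (N + 1) = major u N +
      (∑ v ∈ Ioc p N, descent (u (v - 1)) (u v)) + p * descent (u (p - 1)) x +
        (p + 1) * descent x (u p) - p * descent (u (p - 1)) (u p) := by
  induction N, h using Nat.le_induction with
  | base =>
    unfold major
    rw [sum_range_succ, sum_range_succ, sum_range_succ (n := p)]
    have e : ∑ v ∈ range p, (v : ℤ) * descent (insertLetter u x p (v - 1)) (insertLetter u x p v) =
        ∑ v ∈ range p, (v : ℤ) * descent (u (v - 1)) (u v) := by
      refine sum_congr rfl fun v hv => ?_
      rw [mem_range] at hv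
      unfold insertLetter
      rw [if_pos (by omega), if_pos (by omega)]
    have e1 : (p : ℤ) * descent (insertLetter u x p (p - 1)) (insertLetter u x p p) =
        p * descent (u (p - 1)) x := by
      rcases Nat.eq_zero_or_pos p with rfl | hp
      · simp
      · unfold insertLetter
        rw [if_pos (by omega), if_neg (by omega), if_pos rfl]
    have e2 : insertLetter u x p (p + 1 - 1) = x := by simp [insertLetter]
    have e3 : insertLetter u x p (p + 1) = u p := by simp [insertLetter]
    rw [e, e1, e2, e3]
    simp
    ring
  | succ N hN ih =>
    have e1 : insertLetter u x p (N + 1 + 1 - 1) = u N := by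
      unfold insertLetter
      rw [if_neg (by omega), if_neg (by omega)]; rfl
    have e2 : insertLetter u x p (N + 1 + 1) = u (N + 1) := by
      unfold insertLetter
      rw [if_neg (by omega), if_neg (by omega)]; rfl
    have s1 : major (insertLetter u x p) (N + 1 + 1) =
        major (insertLetter u x p) (N + 1) + ((N : ℤ) + 2) * descent (u N) (u (N + 1)) := by
      unfold major
      rw [sum_range_succ, e1, e2]
      push_cast
      ring
    have s2 : major u (N + 1) = major u N + ((N : ℤ) + 1) * descent (u N) (u (N + 1)) := by
      unfold major
      rw [sum_range_succ]
      push_cast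
      simp
    rw [s1, s2, ih, ← Order.succ_eq_add_one N, ← insert_Ioc_right_eq_Ioc_succ hN,
      sum_insert (by simp)]
    simp only [Order.succ_eq_add_one, Nat.add_sub_cancel]
    ring

/-- Insertions of a new letter at different positions give major indices that differ modulo the
length of the word. -/
theorem eq_of_major_insertLetter_modEq {u : ℕ → ℕ} {x m p q : ℕ} (hx : ∀ v, u v ≠ x) (hxm : x < u m)
    (hp : p ≤ m) (hq : q ≤ m)
    (h : major (insertLetter u x p) (m + 1) ≡ major (insertLetter u x q) (m + 1)
      [ZMOD ((m + 1 : ℕ) : ℤ)]) : p = q := by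
  -- The insertion at `p` raises the number of descents by `1 - ε p`, and the major index by `G p +
  -- p * (1 - ε p)`. By `hG` and `hGm`, `G p` counts the positions in `(p, m]` with `ε = 1`.
  let G : ℕ → ℤ := fun p => ∑ v ∈ Ioc p m, descent (u (v - 1)) (u v) + descent x (u p)
  let ε : ℕ → ℤ := fun p => descent (u (p - 1)) (u p) + 1 - descent (u (p - 1)) x - descent x (u p)
  have hε : ∀ p, ε p = 0 ∨ ε p = 1 := by
    intro p
    have h1 := hx (p - 1)
    have h2 := hx p
    simp only [ε, descent]
    split_ifs <;> omega
  have hG : ∀ k < m, G k = G (k + 1) + ε (k + 1) := by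
    intro k hk
    have h1 := hx k
    have hc : descent (u k) x + descent x (u k) = 1 := by
      unfold descent; split_ifs <;> omega
    simp only [G, ε]
    rw [← insert_Ioc_add_one_left_eq_Ioc hk, sum_insert (by simp), Nat.add_sub_cancel]
    linarith
  have hGm : G m = 0 := by
    simp only [G, descent]; simp; omega
  have hb : ∀ k l, k ≤ l → l ≤ m → G l ≤ G k ∧ G k ≤ G l + (l - k) := by
    intro k l hkl
    induction l, hkl using Nat.le_induction with
    | base => intro _; simp
    | succ l hkl ih =>
      intro hl
      have := ih (by omega)
      have h1 := hG l (by omega)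
      have h2 := hε (l + 1)
      push_cast
      constructor <;> omega
  have hf : ∀ k ≤ m, major (insertLetter u x k) (m + 1) = major u m + (G k + k * (1 - ε k)) := by
    intro k hk
    rw [major_insertLetter u x k m hk]
    simp only [G, ε]
    ring
  have hval : ∀ k : ℕ, (k : ℤ) * (1 - ε k) = if ε k = 0 then (k : ℤ) else 0 := by
    intro k
    rcases hε k with e | e <;> simp [e]
  -- If `ε l = 1`, the increment at `k` is at least `G k > G l`. If `ε l = 0`, it is at most `k + G
  -- k ≤ G l + l - 1`.
  have key : ∀ k l, k < l → l ≤ m → ¬ (G k + k * (1 - ε k) = G l + l * (1 - ε l)) := by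
    intro k l hkl hl
    obtain ⟨l, rfl⟩ : ∃ l', l = l' + 1 := ⟨l - 1, by omega⟩
    have h1 := hb k l (by omega) (by omega)
    have h2 := hG l (by omega)
    rw [hval, hval]
    rcases hε (l + 1) with e | e <;> split_ifs <;> push_cast <;> omega
  -- All increments lie in `[0, m]`, so congruence modulo `m + 1` is equality.
  have hrange : ∀ k ≤ m, 0 ≤ G k + k * (1 - ε k) ∧ G k + k * (1 - ε k) < ((m + 1 : ℕ) : ℤ) := by
    intro k hk
    have := hb k m hk le_rfl
    rw [hval]
    push_cast
    split_ifs <;> constructor <;> omega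
  rw [hf p hp, hf q hq] at h
  have h' := (Int.ModEq.add_left_cancel' _ h).eq
  rw [Int.emod_eq_of_lt (hrange p hp).1 (hrange p hp).2,
    Int.emod_eq_of_lt (hrange q hq).1 (hrange q hq).2] at h'
  rcases lt_trichotomy p q with hlt | heq | hlt
  · exact absurd h' (key p q hlt hq)
  · exact heq
  · exact absurd h'.symm (key q p hlt hp)

/-! ### Deletions -/

/-- The received sequence as a function on `ℕ`, continued by the constant `n`. -/
def received {n : ℕ} (l : List (Fin n)) (k : ℕ) : ℕ := (l[k]?.map Fin.val).getD n

theorem word_eq_insertLetter {n : ℕ} (π : Equiv.Perm (Fin n)) (i : Fin n) :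
    word π = insertLetter (received (deleteAt π i)) (π i) i := by
  funext k
  have hi := i.isLt
  have hu : ∀ k, received (deleteAt π i) k = if k < (i : ℕ) then word π k else word π (k + 1) := by
    intro k
    unfold received deleteAt word
    rw [List.getElem?_eraseIdx]
    simp only [List.getElem?_ofFn]
    split_ifs <;> simp
  unfold insertLetter
  rw [hu, hu]
  rcases lt_trichotomy k (i : ℕ) with h | h | h
  · simp [h]
  · simp [h, word]
  · rw [if_neg (by omega), if_neg (by omega), if_neg (by omega), Nat.sub_add_cancel (by omega)]

theorem mem_deleteAt {n : ℕ} (π : Equiv.Perm (Fin n)) (i y : Fin n) :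
    y ∈ deleteAt π i ↔ y ≠ π i := by
  unfold deleteAt
  rw [List.mem_eraseIdx_iff_getElem]
  constructor
  · rintro ⟨k, hk, hki, rfl⟩ h
    simp only [List.getElem_ofFn] at h
    exact hki (congrArg Fin.val (π.injective h))
  · intro h
    refine ⟨(π.symm y : Fin n), by simp, ?_, by simp⟩
    intro e
    exact h (by rw [← Fin.ext e]; simp)

theorem word_injective {n : ℕ} : Function.Injective (word (n := n)) := by
  intro π σ h
  refine Equiv.ext fun x => Fin.ext ?_
  have := congrFun h x
  rwa [word_lt _ x.isLt, word_lt _ x.isLt] at this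

/-- The deleted letter is the only one absent from the received sequence, so both words arise by
inserting the same letter into the same word. -/
theorem eq_of_deleteAt_eq {n : ℕ} {π σ : Equiv.Perm (Fin n)} {i j : Fin n}
    (h : deleteAt π i = deleteAt σ j) (hc : comajor π ≡ comajor σ [ZMOD (n : ℤ)]) : π = σ := by
  obtain ⟨m, rfl⟩ : ∃ m, n = m + 1 := ⟨n - 1, by have := i.isLt; omega⟩
  have hx : π i = σ j := by
    by_contra hne
    rw [← Ne, ← mem_deleteAt, ← h, mem_deleteAt] at hne
    exact hne rfl
  have hπ := word_eq_insertLetter π i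
  have hσ := word_eq_insertLetter σ j
  rw [← h, ← hx] at hσ
  have hmaj : major (word π) (m + 1) ≡ major (word σ) (m + 1) [ZMOD ((m + 1 : ℕ) : ℤ)] := by
    have h1 := comajor_add_major π
    have h2 := comajor_add_major σ
    rw [Int.modEq_iff_dvd] at hc ⊢
    have e : major (word σ) (m + 1) - major (word π) (m + 1) =
        ((m + 1 : ℕ) : ℤ) * ((∑ k ∈ range (m + 1), descent (word σ k) (word σ (k + 1))) -
          ∑ k ∈ range (m + 1), descent (word π k) (word π (k + 1))) - (comajor σ - comajor π) := by
      rw [mul_sub, ← h1, ← h2]; ring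
    rw [e]
    exact dvd_sub (dvd_mul_right _ _) hc
  rw [hπ, hσ] at hmaj
  have hij : (i : ℕ) = j := by
    refine eq_of_major_insertLetter_modEq (m := m) (fun v hv => ?_) ?_ (by omega) (by omega) hmaj
    · unfold received at hv
      rcases hl : (deleteAt π i)[v]? with _ | y
      · rw [hl] at hv
        have := (π i).isLt
        simp at hv
        omega
      · rw [hl] at hv
        have hy := (mem_deleteAt π i y).mp (List.mem_of_getElem? hl)
        exact hy (Fin.ext (by simpa using hv))
    · have him : (i : ℕ) ≤ m := by omega
      -- The received list has length `m`, so its letter at index `m` is the padding `n`, which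
      -- exceeds the inserted letter.
      have hlen : (deleteAt π i)[m]? = none := by
        rw [List.getElem?_eq_none_iff, deleteAt, List.length_eraseIdx]
        simp [him]
      unfold received
      rw [hlen]
      simpa using (π i).isLt
  apply word_injective
  rw [hπ, hσ, hij]

/-! ### The codes -/

theorem mem_code_iff {T : ℤ} {n : ℕ} {π : Equiv.Perm (Fin n)} :
    π ∈ code T n ↔ R n π⁻¹ ∈ W T n := by
  constructor
  · rintro ⟨a, ha, rfl⟩
    simpa using ha
  · intro h
    exact ⟨_, h, by simp⟩

theorem comajor_add_sum (n : ℕ) (π : Equiv.Perm (Fin n)) :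
    comajor π + ∑ j : Fin n, ((R n π⁻¹).1 j : ℤ) = ∑ j : Fin n, (((j : ℕ) : ℤ) + 1) := by
  have h : ofVec (R n π⁻¹).1 = π⁻¹ := (R n).symm_apply_apply π⁻¹
  have h2 := comajor_ofVec_inv (R n π⁻¹)
  rw [h, inv_inv, sum_sub_distrib] at h2
  linarith

theorem code_singleDeletionCorrecting (T : ℤ) (n : ℕ) : SingleDeletionCorrecting (code T n) := by
  intro π hπ σ hσ i j h
  refine eq_of_deleteAt_eq h ?_
  have h1 := mem_code_iff.mp hπ
  have h2 := mem_code_iff.mp hσ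
  rw [← eq_sub_iff_add_eq.mpr (comajor_add_sum n π) |>.symm,
    ← eq_sub_iff_add_eq.mpr (comajor_add_sum n σ) |>.symm]
  exact Int.ModEq.sub rfl (h1.trans h2.symm)

/-! ### Cardinality of the codes -/

theorem card_V (n : ℕ) : Nat.card (V n) = n.factorial := by
  rw [Nat.card_congr (R n).symm, Nat.card_perm, Nat.card_fin]

/-- Forgetting the last component. -/
def initV {m : ℕ} (a : V (m + 1)) : V m :=
  ⟨fun j => a.1 j.castSucc, fun j => a.2 j.castSucc⟩

/-- The last component ranges over `1, …, m + 1`, which meets each residue class modulo `m + 1`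
once; the congruence therefore determines it from the others. -/
theorem initV_bijective (T : ℤ) (m : ℕ) :
    Function.Bijective fun a : W T (m + 1) => initV a.1 := by
  constructor
  · rintro ⟨a, ha⟩ ⟨b, hb⟩ h
    have hinit : ∀ j : Fin m, a.1 j.castSucc = b.1 j.castSucc :=
      fun j => congrFun (congrArg Subtype.val h) j
    have hab := Int.ModEq.trans ha (Int.ModEq.symm hb)
    rw [Fin.sum_univ_castSucc, Fin.sum_univ_castSucc, sum_congr rfl fun j _ => by rw [hinit j]]
      at hab
    have hl := Int.ModEq.add_left_cancel' _ hab
    have h1 := a.2 (Fin.last m)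
    have h2 := b.2 (Fin.last m)
    rw [Fin.val_last] at h1 h2
    have hl' := (hl.sub_right 1).eq
    rw [Int.emod_eq_of_lt (by omega) (by omega), Int.emod_eq_of_lt (by omega) (by omega)] at hl'
    refine Subtype.ext (Subtype.ext (funext fun j => ?_))
    induction j using Fin.lastCases with
    | last => show a.1 _ = b.1 _; omega
    | cast j => exact hinit j
  · intro b
    -- The missing component is `r + 1`: the shift by one moves the residues `0, …, m` to `1, …, m +
    -- 1`.
    let r : ℤ := (T - ∑ j, (b.1 j : ℤ) - 1) % ((m + 1 : ℕ) : ℤ)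
    have hr0 : 0 ≤ r := Int.emod_nonneg _ (by omega)
    have hr1 : r < ((m + 1 : ℕ) : ℤ) := Int.emod_lt_of_pos _ (by omega)
    let c : Fin (m + 1) → ℕ := Fin.snoc (α := fun _ => ℕ) b.1 (r.toNat + 1)
    have hcc : ∀ j : Fin m, c j.castSucc = b.1 j := fun j => Fin.snoc_castSucc (α := fun _ => ℕ) ..
    have hcl : c (Fin.last m) = r.toNat + 1 := Fin.snoc_last (α := fun _ => ℕ) ..
    have hc : c ∈ V (m + 1) := by
      intro j
      induction j using Fin.lastCases with
      | last => rw [hcl, Fin.val_last]; omega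
      | cast j => rw [hcc]; exact b.2 j
    refine ⟨⟨⟨c, hc⟩, ?_⟩, Subtype.ext (funext hcc)⟩
    show ∑ j, (c j : ℤ) ≡ T [ZMOD _]
    rw [Fin.sum_univ_castSucc, hcl, sum_congr rfl fun j _ => by rw [hcc j]]
    have hmod : r ≡ T - ∑ j, (b.1 j : ℤ) - 1 [ZMOD ((m + 1 : ℕ) : ℤ)] := Int.mod_modEq _ _
    have := (hmod.add_left (∑ j, (b.1 j : ℤ))).add_right 1
    push_cast [Int.toNat_of_nonneg hr0] at this ⊢
    rw [← add_assoc]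
    convert this using 1
    ring

theorem ncard_code (T : ℤ) {n : ℕ} (hn : 0 < n) : (code T n).ncard = (n - 1).factorial := by
  obtain ⟨m, rfl⟩ : ∃ m, n = m + 1 := ⟨n - 1, by omega⟩
  have e : code T (m + 1) = (fun a => ((R (m + 1)).symm a)⁻¹) '' W T (m + 1) := by
    ext π
    exact ⟨fun ⟨a, ha, h⟩ => ⟨a, ha, h.symm⟩, fun ⟨a, ha, h⟩ => ⟨a, ha, h.symm⟩⟩
  have hinj : Function.Injective fun a => ((R (m + 1)).symm a)⁻¹ :=
    inv_injective.comp (R (m + 1)).symm.injective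
  rw [e, Set.ncard_image_of_injective _ hinj,
    ← Nat.card_coe_set_eq, Nat.card_congr (Equiv.ofBijective _ (initV_bijective T m)), card_V,
    Nat.add_sub_cancel]

theorem code_nonempty (T : ℤ) {n : ℕ} (hn : 0 < n) : (code T n).Nonempty := by
  apply Set.nonempty_of_ncard_ne_zero
  rw [ncard_code T hn]
  exact Nat.factorial_ne_zero _

/-! ### Partition into codes -/

theorem isPartition_range_code {n : ℕ} (hn : 0 < n) :
    Setoid.IsPartition (Set.range fun t : Fin n => code ((t : ℕ) : ℤ) n) := by
  constructor
  · rintro ⟨t, ht⟩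
    exact (code_nonempty _ hn).ne_empty ht
  · intro π
    let S : ℤ := ∑ j : Fin n, ((R n π⁻¹).1 j : ℤ)
    have h0 : 0 ≤ S % n := Int.emod_nonneg _ (by omega)
    have h1 : S % n < n := Int.emod_lt_of_pos _ (by omega)
    refine ⟨code (S % n) n, ⟨⟨⟨(S % n).toNat, by omega⟩, ?_⟩, ?_⟩, ?_⟩
    · simp only [Int.toNat_of_nonneg h0]
    · exact mem_code_iff.mpr (Int.mod_modEq S n).symm
    · rintro _ ⟨⟨t, rfl⟩, ht⟩
      have h : S % n = (t : ℕ) % (n : ℤ) := mem_code_iff.mp ht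
      have hlt : ((t : ℕ) : ℤ) < n := by exact_mod_cast t.isLt
      rw [h, Int.emod_eq_of_lt (by positivity) hlt]

theorem disjoint_code {T₁ T₂ : ℤ} {n : ℕ} (h : ¬ T₁ ≡ T₂ [ZMOD (n : ℤ)]) :
    Disjoint (code T₁ n) (code T₂ n) :=
  Set.disjoint_left.mpr fun _ h1 h2 =>
    h (Int.ModEq.trans (Int.ModEq.symm (mem_code_iff.mp h1)) (mem_code_iff.mp h2))

end DeletionCode

theorem mainTheorem1 (n : ℕ) (hn : 0 < n) :
    (∀ T₁ T₂ : ℤ, ¬ T₁ ≡ T₂ [ZMOD (n : ℤ)] →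
      Disjoint (DeletionCode.code T₁ n) (DeletionCode.code T₂ n)) ∧
    Setoid.IsPartition (Set.range fun t : Fin n => DeletionCode.code ((t : ℕ) : ℤ) n) ∧
    (∀ T : ℤ,
      (DeletionCode.code T n).ncard = (n - 1).factorial ∧
      DeletionCode.SingleDeletionCorrecting (DeletionCode.code T n) ∧
      DeletionCode.IsPerfect (DeletionCode.code T n)) :=
  ⟨fun _ _ h => DeletionCode.disjoint_code h, DeletionCode.isPartition_range_code hn, fun T =>
    ⟨DeletionCode.ncard_code T hn, DeletionCode.code_singleDeletionCorrecting T n,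
      DeletionCode.code_singleDeletionCorrecting T n, DeletionCode.ncard_code T hn⟩⟩
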